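/- **Setting.** In the online covering problem with $n$ resources and a cost function $f:\mathbb{R}^n_+\to\mathbb{R}_+$ (known in advance), requests $a_1,a_2,\dots\in\mathbb{R}^n_+\setminus\{0\}$ arrive one by one. A (deterministic) online covering algorithm maintains a vector $x\in\mathbb{R}^n_+$, initially $0$; when $a_j$ arrives it must, knowing only $a_1,\dots,a_j$, increase some coordinates of $x$ (never decreasing any) so that $\langle a_j,x\rangle\ge 1$. It is $\alpha$-competitive with respect to $f$ if, after every finite sequence of requests $a_1,\dots,a_m$, its vector $x$ satisfies $f(x)\le\alpha\cdot\inf\{f(z): z\in\mathbb{R}^n_+,\ \langle a_j,z\rangle\ge 1 \text{ for all } j\le m\}$. Let $c_1,\dots,c_l\in\mathbb{R}^n_+$ be vectors, each with at most $d$ non-zero coordinates, where $d\ge 2$, and put $\lambda_k(x)=\langle c_k,x\rangle$ and $\lambda(x)=(\lambda_1(x),\dots,\lambda_l(x))$ for $x\in\mathbb{R}^n_+$. **Statement.** 1. There is an absolute constant $C>0$ such that for all $n,l$, all $d\ge2$, all such $c_1,\dots,c_l$ and every real $p\ge 2$ there is an online covering algorithm that is $(C\,p\log d)^p$-competitive with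 respect to $f(x)=\sum_{k=1}^l\lambda_k(x)^p$ and $(C\,p\log d)$-competitive with respect to $\|\lambda(x)\|_p$. 2. These two assertions are equivalent: for every real $p\ge2$ and $r\ge 0$, an online covering algorithm is $r^p$-competitive with respect to $f$ if and only if it is $r$-competitive with respect to $\|\lambda(x)\|_p$. 3. There is an absolute constant $C>0$ such that for all $n$, all $l\ge2$, all $d\ge2$ and all such $c_1,\dots,c_l$ there is an online covering algorithm that is $(C\log l\,\log d)$-competitive with respect to $\|\lambda(x)\|_\infty=\max_k\lambda_k(x)$, i.e. for online mixed packing and covering, where the maximum congestion of the packing constraints is minimized. -/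

import Mathlib

open scoped ENNReal

namespace OnlineCovering

/-- A covering request over `n` resources: the constraint `⟨a, x⟩ ≥ 1` for a vector `a` with
non-negative entries. The vector is non-zero, since `⟨0, x⟩ ≥ 1` can never be satisfied. -/
def Request (n : ℕ) : Type := {a : Fin n → ℝ // 0 ≤ a ∧ a ≠ 0}

/-- The amount vector `x` satisfies the request `a`. -/
def Request.SatisfiedBy {n : ℕ} (a : Request n) (x : Fin n → ℝ) : Prop :=
  1 ≤ a.val ⬝ᵥ x

/-- The offline feasible region: all `x ∈ ℝ₊ⁿ` satisfying every request of the list. -/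
def feasible {n : ℕ} (as : List (Request n)) : Set (Fin n → ℝ) :=
  {x | 0 ≤ x ∧ ∀ a ∈ as, a.SatisfiedBy x}

/-- The offline optimum of the cost `f` subject to the requests `as`. -/
noncomputable def offlineOpt {n : ℕ} (f : (Fin n → ℝ) → ℝ) (as : List (Request n)) : ℝ :=
  sInf (f '' feasible as)

/-- A (deterministic) online covering algorithm. Its vector `x` after a finite sequence of
requests (listed in order of arrival) is a function of these requests only; it starts at `0`,
no coordinate is ever decreased, and each request is satisfied as soon as it arrives. Since
request vectors are non-negative, a satisfied request stays satisfied. -/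
structure Algorithm (n : ℕ) where
  assign : List (Request n) → (Fin n → ℝ)
  assign_nil : assign [] = 0
  le_assign_concat : ∀ (as : List (Request n)) (a : Request n), assign as ≤ assign (as ++ [a])
  satisfies : ∀ (as : List (Request n)) (a : Request n), a.SatisfiedBy (assign (as ++ [a]))

/-- `A` is `α`-competitive for the cost `f`: after every finite request sequence its cost is at
most `α` times the offline optimum for that sequence. -/
def Algorithm.IsCompetitive {n : ℕ} (A : Algorithm n) (f : (Fin n → ℝ) → ℝ) (α : ℝ) : Prop :=
  ∀ as : List (Request n), f (A.assign as) ≤ α * offlineOpt f as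

/-- The linear functions `λ_k(x) = ⟨c_k, x⟩`. -/
def load {n l : ℕ} (c : Fin l → Fin n → ℝ) (x : Fin n → ℝ) : Fin l → ℝ :=
  fun k => c k ⬝ᵥ x

/-- The cost `∑_k λ_k(x) ^ p`. -/
noncomputable def powerCost {n l : ℕ} (c : Fin l → Fin n → ℝ) (p : ℝ) (x : Fin n → ℝ) : ℝ :=
  ∑ k, load c x k ^ p

/-- The cost `‖λ(x)‖_p`, for `p` possibly infinite. For `p = ∞` it is `max_k λ_k(x)` on `ℝ₊ⁿ`, the
maximum congestion of the packing constraints, i.e. the cost of mixed packing and covering. -/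
noncomputable def normCost {n l : ℕ} (c : Fin l → Fin n → ℝ) (p : ℝ≥0∞) (x : Fin n → ℝ) : ℝ :=
  ‖WithLp.toLp p (load c x)‖

end OnlineCovering

/-! Let F(x) = ∑ λ_k(x)^p, let p·g_i be its partial derivatives and C_i = ∑_k c_ki^p. A
multiplicative update x_i' = a_i x_i / g_i raises F at rate p⟨a, x⟩ ≤ p while a is unsatisfied, but
analysing it needs a lower bound on x_i relative to the offline amount. Here the lower bound adapts
itself: s_i (`level`) solves C_i s_i^(p-1) = g_i, the algorithm holds u = x + s/d, and x_i' = a_i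
u_i / g_i. As each λ_k involves at most d coordinates, F(s/d) ≤ F(x), so the reserve s/d costs only
a factor 2^p (`powerCost_add_reserve_le`).

For an offline z, take the potential Φ to be ∑ z_i g_i log(u_i / z_i), truncated at u_i = 2 z_i and
corrected so that it is nonnegative and does not fall as the g_i grow. While ⟨a, u⟩ ≤ 1 ≤ ⟨a, z⟩,
the coordinates with u_i > 2 z_i account for at most 1/2 of ⟨a, z⟩, so Φ grows at a constant rate
and pays for F (`powerCost_eulerStep_sub_le`, with finite steps replacing the flow). Thus F(x) ≤
F(z) + 24pΦ. Also Φ ≤ log(4d) ∑ λ_k(z) λ_k(x)^(p-1) + F(z), and Young's inequality absorbs the part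
in F(x), leaving F(x) ≤ O(p log d)^p F(z) (`powerCost_le_of_le_potential`). The update never uses z,
so this holds for all feasible z at once.

The norm bound is the p-th root; the maximum is approximated by the p-norm with p = 3 log l. -/

namespace OnlineCovering

/-! ### One-coordinate potential and scalar inequalities. -/

section Scalar

/-- The contribution of one coordinate to the potential, per unit of the offline amount `z`:
`g` is the marginal cost, `u` the online amount, `G` the marginal cost at `z` alone. -/
noncomputable def coordPot (q D G z g u : ℝ) : ℝ :=
  g * (Real.log (min u (2 * z)) - Real.log z + Real.log (2 * D)
    + (Real.log G - Real.log (min g G)) / q) + min g G / q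

/-- The reserve keeps u at least s / D, where C s^q = g₀. When s < z, the negative log(s / z) is
cancelled by the correction (log G - log g) / q with G = C z^q. The 2 in log(2D) absorbs the gap
between g₁ and g₀, at most 2^q. -/
theorem coordPot_bracket_nonneg {q D C z g₀ g₁ u : ℝ} (hq : 1 ≤ q) (hD : 1 ≤ D) (hC : 0 < C)
    (hz : 0 < z) (hg₀ : 0 < g₀) (hg₁ : 0 < g₁) (hg : g₁ ≤ 2 ^ q * g₀)
    (hu : (g₀ / C) ^ q⁻¹ / D ≤ u) :
    0 ≤ Real.log (min u (2 * z)) - Real.log z + Real.log (2 * D)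
      + (Real.log (C * z ^ q) - Real.log (min g₁ (C * z ^ q))) / q := by
  have hq0 : 0 < q := by linarith
  have hG : 0 < C * z ^ q := by positivity
  have hm : 0 < min g₁ (C * z ^ q) := lt_min hg₁ hG
  have hlogD : 0 ≤ Real.log D := Real.log_nonneg hD
  have hlog2 : 0 < Real.log 2 := Real.log_pos (by norm_num)
  rw [Real.log_mul (by norm_num : (2 : ℝ) ≠ 0) (by linarith : D ≠ 0)]
  rcases le_total u (2 * z) with h | h
  · rw [min_eq_left h]
    have hpos : 0 < (g₀ / C) ^ q⁻¹ / D := by positivity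
    have h1 : Real.log ((g₀ / C) ^ q⁻¹ / D) ≤ Real.log u := Real.log_le_log hpos hu
    rw [Real.log_div (by positivity) (by linarith), Real.log_rpow (by positivity),
      Real.log_div hg₀.ne' hC.ne'] at h1
    have h2 : Real.log (min g₁ (C * z ^ q)) ≤ q * Real.log 2 + Real.log g₀ := by
      rw [← Real.log_rpow (by norm_num), ← Real.log_mul (by positivity) hg₀.ne']
      exact Real.log_le_log hm ((min_le_left _ _).trans hg)
    have h3 : Real.log (C * z ^ q) = Real.log C + q * Real.log z := by
      rw [Real.log_mul hC.ne' (by positivity), Real.log_rpow hz]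
    rw [h3]
    have h4 : (Real.log C + q * Real.log z - (q * Real.log 2 + Real.log g₀)) / q
        ≤ (Real.log C + q * Real.log z - Real.log (min g₁ (C * z ^ q))) / q := by gcongr
    have h5 : (Real.log C + q * Real.log z - (q * Real.log 2 + Real.log g₀)) / q
        = Real.log z - Real.log 2 - q⁻¹ * (Real.log g₀ - Real.log C) := by
      field_simp; ring
    linarith
  · rw [min_eq_right h, Real.log_mul (by norm_num) hz.ne']
    have : 0 ≤ (Real.log (C * z ^ q) - Real.log (min g₁ (C * z ^ q))) / q :=
      div_nonneg (sub_nonneg.2 (Real.log_le_log hm (min_le_right _ _))) hq0.le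
    linarith

theorem coordPot_nonneg {q D C z g u : ℝ} (hq : 1 ≤ q) (hD : 1 ≤ D) (hC : 0 < C)
    (hz : 0 < z) (hg : 0 < g) (hu : (g / C) ^ q⁻¹ / D ≤ u) :
    0 ≤ coordPot q D (C * z ^ q) z g u := by
  have h2 : g ≤ 2 ^ q * g :=
    le_mul_of_one_le_left hg.le (Real.one_le_rpow (by norm_num) (by linarith))
  have h := coordPot_bracket_nonneg hq hD hC hz hg hg h2 hu
  have hG : 0 < C * z ^ q := by positivity
  exact add_nonneg (mul_nonneg hg.le h) (div_nonneg (lt_min hg hG).le (by linarith))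

/-- Truncation at 2z caps the main logarithm, and the correction terms sum to at most G, because g
log(G / g) + g ≤ G by log t ≤ t - 1. -/
theorem coordPot_le {q D C z g u : ℝ} (hq : 1 ≤ q) (hD : 1 ≤ D) (hC : 0 < C)
    (hz : 0 < z) (hg : 0 < g) (hu : 0 < u) :
    coordPot q D (C * z ^ q) z g u ≤ g * Real.log (4 * D) + C * z ^ q := by
  have hq0 : 0 < q := by linarith
  set G := C * z ^ q with hGdef
  have hG : 0 < G := by positivity
  have hX : Real.log (min u (2 * z)) ≤ Real.log 2 + Real.log z := by
    rw [← Real.log_mul (by norm_num) hz.ne']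
    exact Real.log_le_log (lt_min hu (by positivity)) (min_le_right _ _)
  have h4 : Real.log (4 * D) = Real.log 2 + Real.log (2 * D) := by
    rw [← Real.log_mul (by norm_num) (by positivity)]; ring_nf
  have hkey : g * (Real.log G - Real.log (min g G)) + min g G ≤ G := by
    rcases le_total g G with h | h
    · rw [min_eq_left h, ← Real.log_div hG.ne' hg.ne']
      have := Real.log_le_sub_one_of_pos (div_pos hG hg)
      have h' := mul_le_mul_of_nonneg_left this hg.le
      have : g * (G / g - 1) = G - g := by field_simp
      linarith
    · rw [min_eq_right h]; simp
  have hkey' : (g * (Real.log G - Real.log (min g G)) + min g G) / q ≤ G :=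
    (div_le_div_of_nonneg_right hkey hq0.le).trans (div_le_self hG.le hq)
  have h5 : g * (Real.log (min u (2 * z)) - Real.log z + Real.log (2 * D))
      ≤ g * Real.log (4 * D) := by
    apply mul_le_mul_of_nonneg_left _ hg.le; linarith
  have h6 : coordPot q D G z g u = g * (Real.log (min u (2 * z)) - Real.log z + Real.log (2 * D))
      + (g * (Real.log G - Real.log (min g G)) + min g G) / q := by
    unfold coordPot; ring
  linarith

/-- Raising g at fixed u cannot lower the potential: the change is (g₁ - g₀) times the nonnegative
bracket, plus a remainder in which the summand min g G / q outweighs the change of the logarithm.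
Only the gain from u is kept. -/
theorem coordPot_sub_ge {q D C z g₀ g₁ u₀ u₁ : ℝ} (hq : 1 ≤ q) (hD : 1 ≤ D) (hC : 0 < C)
    (hz : 0 < z) (hg₀ : 0 < g₀) (hg₀₁ : g₀ ≤ g₁) (hg : g₁ ≤ 2 ^ q * g₀)
    (hu : (g₀ / C) ^ q⁻¹ / D ≤ u₀) :
    g₁ * (Real.log (min u₁ (2 * z)) - Real.log (min u₀ (2 * z)))
      ≤ coordPot q D (C * z ^ q) z g₁ u₁ - coordPot q D (C * z ^ q) z g₀ u₀ := by
  have hq0 : 0 < q := by linarith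
  have h1 := mul_nonneg (sub_nonneg.2 hg₀₁)
    (coordPot_bracket_nonneg hq hD hC hz hg₀ (hg₀.trans_le hg₀₁) hg hu)
  set G := C * z ^ q with hGdef
  have hG : 0 < G := by positivity
  have h2 : g₀ * (Real.log (min g₁ G) - Real.log (min g₀ G)) ≤ min g₁ G - min g₀ G := by
    rcases le_total g₀ G with h | h
    · have hm : 0 < min g₁ G := lt_min (hg₀.trans_le hg₀₁) hG
      rw [min_eq_left h, ← Real.log_div hm.ne' hg₀.ne']
      have h' := mul_le_mul_of_nonneg_left (Real.log_le_sub_one_of_pos (div_pos hm hg₀)) hg₀.le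
      have : g₀ * (min g₁ G / g₀ - 1) = min g₁ G - g₀ := by field_simp
      linarith
    · rw [min_eq_right h, min_eq_right (h.trans hg₀₁)]; simp
  have h3 : 0 ≤ (min g₁ G - min g₀ G - g₀ * (Real.log (min g₁ G) - Real.log (min g₀ G))) / q :=
    div_nonneg (by linarith) hq0.le
  have h4 : coordPot q D G z g₁ u₁ - coordPot q D G z g₀ u₀
      = g₁ * (Real.log (min u₁ (2 * z)) - Real.log (min u₀ (2 * z)))
      + (g₁ - g₀) * (Real.log (min u₀ (2 * z)) - Real.log z + Real.log (2 * D)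
        + (Real.log G - Real.log (min g₁ G)) / q)
      + (min g₁ G - min g₀ G - g₀ * (Real.log (min g₁ G) - Real.log (min g₀ G))) / q := by
    unfold coordPot; ring
  linarith

/-- Bernoulli's inequality at -t / (s + t) bounds the difference by p (s + t)^(p-1) t, and (1 +
1/p)^(p-1) ≤ e < 3. -/
theorem rpow_add_sub_rpow_le {p s t : ℝ} (hp : 1 ≤ p) (hs : 0 ≤ s) (ht : 0 ≤ t)
    (hts : t ≤ s / p) : (s + t) ^ p - s ^ p ≤ 3 * p * (s ^ (p - 1) * t) := by
  have hp0 : 0 < p := by linarith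
  rcases hs.eq_or_lt with rfl | hs
  · have : t = 0 := le_antisymm (by simpa using hts) ht
    simp [this]
  have hst : 0 < s + t := by linarith
  have h1 := one_add_mul_self_le_rpow_one_add (s := -(t / (s + t))) (by
    rw [neg_le_neg_iff, div_le_one hst]; linarith) hp
  have h2 : 1 + -(t / (s + t)) = s / (s + t) := by field_simp; ring
  rw [h2, Real.div_rpow hs.le hst.le, le_div_iff₀ (by positivity)] at h1
  have h3 : (s + t) ^ p = (s + t) ^ (p - 1) * (s + t) := by
    rw [← Real.rpow_add_one hst.ne']; congr 1; ring
  have h4 : (1 + p * -(t / (s + t))) * (s + t) ^ p = (s + t) ^ p - p * ((s + t) ^ (p - 1) * t) := by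
    rw [h3]; field_simp; ring
  have h5 : (s + t) ^ (p - 1) ≤ 3 * s ^ (p - 1) := by
    have h6 : s + t ≤ s * Real.exp (1 / p) := by
      have := Real.add_one_le_exp (1 / p)
      have h7 := mul_le_mul_of_nonneg_left this hs.le
      have : s * (1 / p + 1) = s + s / p := by ring
      linarith
    calc (s + t) ^ (p - 1) ≤ (s * Real.exp (1 / p)) ^ (p - 1) :=
          Real.rpow_le_rpow hst.le h6 (by linarith)
      _ = s ^ (p - 1) * Real.exp (1 / p * (p - 1)) := by
          rw [Real.mul_rpow hs.le (Real.exp_pos _).le, ← Real.exp_mul]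
      _ ≤ s ^ (p - 1) * 3 := by
          gcongr
          have : 1 / p * (p - 1) ≤ 1 := by
            rw [one_div, inv_mul_le_iff₀ hp0]; linarith
          exact (Real.exp_le_exp.2 this).trans (by linarith [Real.exp_one_lt_d9])
      _ = _ := by ring
  have h8 : p * ((s + t) ^ (p - 1) * t) ≤ p * (3 * s ^ (p - 1) * t) := by gcongr
  linarith

/-- Young's inequality with exponents p and p / (p - 1). The coefficient 1 - 1/p < 1 is what lets
the last term be absorbed later. -/
theorem mul_rpow_sub_one_le {p s t : ℝ} (hp : 1 < p) (hs : 0 ≤ s) (ht : 0 ≤ t) :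
    s * t ^ (p - 1) ≤ s ^ p / p + (1 - 1 / p) * t ^ p := by
  have hc : p.HolderConjugate (p / (p - 1)) := Real.HolderConjugate.conjExponent hp
  have h := Real.young_inequality_of_nonneg hs (Real.rpow_nonneg ht (p - 1)) hc
  have hp1 : p - 1 ≠ 0 := by linarith
  have hp0 : p ≠ 0 := by linarith
  rw [← Real.rpow_mul ht, mul_div_cancel₀ _ hp1] at h
  convert h using 2
  field_simp

theorem sum_rpow_le_rpow_sum {ι : Type*} (s : Finset ι) {f : ι → ℝ} {p : ℝ} (hp : 1 ≤ p)
    (hf : ∀ i ∈ s, 0 ≤ f i) : ∑ i ∈ s, f i ^ p ≤ (∑ i ∈ s, f i) ^ p := by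
  have h0 : 0 ≤ ∑ i ∈ s, f i := Finset.sum_nonneg hf
  have key : ∀ y : ℝ, 0 ≤ y → y ^ p = y * y ^ (p - 1) := fun y hy => by
    rw [← Real.rpow_one_add' hy (by linarith)]; congr 1; ring
  rw [key _ h0, Finset.sum_mul]
  refine Finset.sum_le_sum fun i hi => ?_
  rw [key _ (hf i hi)]
  exact mul_le_mul_of_nonneg_left (Real.rpow_le_rpow (hf i hi)
    (Finset.single_le_sum hf hi) (by linarith)) (hf i hi)

end Scalar

/-! ### Marginal costs, and the cost of the reserve. -/

section Cost

variable {n l : ℕ} {c : Fin l → Fin n → ℝ} {p : ℝ}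

/-- The partial derivative of `powerCost c p` in direction `i`, divided by `p`. -/
noncomputable def marginal (c : Fin l → Fin n → ℝ) (p : ℝ) (x : Fin n → ℝ) (i : Fin n) : ℝ :=
  ∑ k, c k i * load c x k ^ (p - 1)

/-- The power cost of one unit of resource `i` alone. -/
noncomputable def colPow (c : Fin l → Fin n → ℝ) (p : ℝ) (i : Fin n) : ℝ :=
  ∑ k, c k i ^ p

/-- The amount of resource `i` whose stand-alone marginal cost is the present one. -/
noncomputable def level (c : Fin l → Fin n → ℝ) (p : ℝ) (x : Fin n → ℝ) (i : Fin n) : ℝ :=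
  (marginal c p x i / colPow c p i) ^ (p - 1)⁻¹

/-- The amounts which the algorithm holds in addition to `x`. -/
noncomputable def reserve (c : Fin l → Fin n → ℝ) (p D : ℝ) (x : Fin n → ℝ) (i : Fin n) : ℝ :=
  level c p x i / D

/-- The potential of `x` with respect to the offline vector `z`. -/
noncomputable def potential (c : Fin l → Fin n → ℝ) (p D : ℝ) (x z : Fin n → ℝ) : ℝ :=
  ∑ i, z i * coordPot (p - 1) D (colPow c p i * z i ^ (p - 1)) (z i) (marginal c p x i)
    (x i + reserve c p D x i)

theorem load_eq_sum (x : Fin n → ℝ) (k : Fin l) : load c x k = ∑ i, c k i * x i := rfl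

theorem load_nonneg (hc : ∀ k i, 0 ≤ c k i) {x : Fin n → ℝ} (hx : 0 ≤ x) (k : Fin l) :
    0 ≤ load c x k :=
  load_eq_sum (c := c) x k ▸ Finset.sum_nonneg fun i _ => mul_nonneg (hc k i) (hx i)

theorem load_mono (hc : ∀ k i, 0 ≤ c k i) {x y : Fin n → ℝ} (hxy : x ≤ y) (k : Fin l) :
    load c x k ≤ load c y k := by
  rw [load_eq_sum, load_eq_sum]
  exact Finset.sum_le_sum fun i _ => mul_le_mul_of_nonneg_left (hxy i) (hc k i)

theorem mul_le_load (hc : ∀ k i, 0 ≤ c k i) {x : Fin n → ℝ} (hx : 0 ≤ x) (k : Fin l) (i : Fin n) :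
    c k i * x i ≤ load c x k :=
  Finset.single_le_sum (f := fun i => c k i * x i) (fun i _ => mul_nonneg (hc k i) (hx i))
    (Finset.mem_univ i)

theorem load_add (x y : Fin n → ℝ) (k : Fin l) : load c (x + y) k = load c x k + load c y k :=
  dotProduct_add _ _ _

theorem load_smul (b : ℝ) (x : Fin n → ℝ) (k : Fin l) : load c (b • x) k = b * load c x k :=
  dotProduct_smul _ _ _

theorem load_congr {x y : Fin n → ℝ} (h : ∀ i, (∃ k, c k i ≠ 0) → x i = y i) :
    load c x = load c y := by
  funext k
  rw [load_eq_sum, load_eq_sum]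
  refine Finset.sum_congr rfl fun i _ => ?_
  by_cases hk : c k i = 0
  · simp [hk]
  · rw [h i ⟨k, hk⟩]

theorem powerCost_nonneg (hc : ∀ k i, 0 ≤ c k i) {x : Fin n → ℝ} (hx : 0 ≤ x) :
    0 ≤ powerCost c p x :=
  Finset.sum_nonneg fun k _ => Real.rpow_nonneg (load_nonneg hc hx k) _

theorem marginal_nonneg (hc : ∀ k i, 0 ≤ c k i) {x : Fin n → ℝ} (hx : 0 ≤ x) (i : Fin n) :
    0 ≤ marginal c p x i :=
  Finset.sum_nonneg fun k _ => mul_nonneg (hc k i) (Real.rpow_nonneg (load_nonneg hc hx k) _)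

theorem marginal_mono (hp : 1 ≤ p) (hc : ∀ k i, 0 ≤ c k i) {x y : Fin n → ℝ} (hx : 0 ≤ x)
    (hxy : x ≤ y) (i : Fin n) : marginal c p x i ≤ marginal c p y i :=
  Finset.sum_le_sum fun k _ => mul_le_mul_of_nonneg_left
    (Real.rpow_le_rpow (load_nonneg hc hx k) (load_mono hc hxy k) (by linarith)) (hc k i)

theorem marginal_smul (hc : ∀ k i, 0 ≤ c k i) {x : Fin n → ℝ} (hx : 0 ≤ x) {b : ℝ} (hb : 0 ≤ b)
    (i : Fin n) : marginal c p (b • x) i = b ^ (p - 1) * marginal c p x i := by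
  simp only [marginal, load_smul, Finset.mul_sum]
  refine Finset.sum_congr rfl fun k _ => ?_
  rw [Real.mul_rpow hb (load_nonneg hc hx k)]; ring

theorem marginal_pos (hc : ∀ k i, 0 ≤ c k i) {x : Fin n → ℝ} (hx : ∀ i, 0 < x i) {i : Fin n}
    (hi : ∃ k, c k i ≠ 0) : 0 < marginal c p x i := by
  obtain ⟨k, hk⟩ := hi
  have hx0 : 0 ≤ x := fun i => (hx i).le
  have hk' : 0 < c k i := lt_of_le_of_ne (hc k i) (Ne.symm hk)
  have hl : 0 < load c x k := (mul_pos hk' (hx i)).trans_le (mul_le_load hc hx0 k i)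
  refine (mul_pos hk' (Real.rpow_pos_of_pos hl _)).trans_le
    (Finset.single_le_sum (f := fun k => c k i * load c x k ^ (p - 1)) (fun k _ => mul_nonneg
      (hc k i) (Real.rpow_nonneg (load_nonneg hc hx0 k) _)) (Finset.mem_univ k))

theorem marginal_eq_zero {x : Fin n → ℝ} {i : Fin n} (hi : ¬ ∃ k, c k i ≠ 0) :
    marginal c p x i = 0 := by
  push Not at hi
  simp [marginal, hi]

theorem colPow_nonneg (hc : ∀ k i, 0 ≤ c k i) (i : Fin n) : 0 ≤ colPow c p i :=
  Finset.sum_nonneg fun k _ => Real.rpow_nonneg (hc k i) _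

theorem colPow_pos (hc : ∀ k i, 0 ≤ c k i) {i : Fin n} (hi : ∃ k, c k i ≠ 0) :
    0 < colPow c p i := by
  obtain ⟨k, hk⟩ := hi
  have hk' : 0 < c k i := lt_of_le_of_ne (hc k i) (Ne.symm hk)
  exact (Real.rpow_pos_of_pos hk' p).trans_le (Finset.single_le_sum (f := fun k => c k i ^ p)
    (fun k _ => Real.rpow_nonneg (hc k i) _) (Finset.mem_univ k))

theorem level_nonneg (hc : ∀ k i, 0 ≤ c k i) {x : Fin n → ℝ} (hx : 0 ≤ x) (i : Fin n) :
    0 ≤ level c p x i :=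
  Real.rpow_nonneg (div_nonneg (marginal_nonneg hc hx i) (colPow_nonneg hc i)) _

theorem level_mono (hp : 1 ≤ p) (hc : ∀ k i, 0 ≤ c k i) {x y : Fin n → ℝ} (hx : 0 ≤ x)
    (hxy : x ≤ y) (i : Fin n) : level c p x i ≤ level c p y i :=
  Real.rpow_le_rpow (div_nonneg (marginal_nonneg hc hx i) (colPow_nonneg hc i))
    (div_le_div_of_nonneg_right (marginal_mono hp hc hx hxy i) (colPow_nonneg hc i))
    (inv_nonneg.2 (by linarith))

theorem reserve_nonneg (hc : ∀ k i, 0 ≤ c k i) {D : ℝ} (hD : 0 ≤ D) {x : Fin n → ℝ} (hx : 0 ≤ x) :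
    0 ≤ reserve c p D x :=
  fun i => div_nonneg (level_nonneg hc hx i) hD

theorem reserve_mono (hp : 1 ≤ p) (hc : ∀ k i, 0 ≤ c k i) {D : ℝ} (hD : 0 ≤ D) {x y : Fin n → ℝ}
    (hx : 0 ≤ x) (hxy : x ≤ y) : reserve c p D x ≤ reserve c p D y :=
  fun i => div_le_div_of_nonneg_right (level_mono hp hc hx hxy i) hD

theorem sum_mul_marginal (x z : Fin n → ℝ) :
    ∑ i, z i * marginal c p x i = ∑ k, load c z k * load c x k ^ (p - 1) := by
  simp only [marginal, Finset.mul_sum]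
  rw [Finset.sum_comm]
  refine Finset.sum_congr rfl fun k _ => ?_
  simp only [load, dotProduct, Finset.sum_mul]
  exact Finset.sum_congr rfl fun i _ => by ring

theorem sum_colPow_mul_rpow_le (hp : 1 ≤ p) (hc : ∀ k i, 0 ≤ c k i) {z : Fin n → ℝ} (hz : 0 ≤ z) :
    ∑ i, colPow c p i * z i ^ p ≤ powerCost c p z := by
  simp only [colPow, Finset.sum_mul]
  rw [Finset.sum_comm]
  refine Finset.sum_le_sum fun k _ => ?_
  simp only [← Real.mul_rpow (hc k _) (hz _)]
  exact sum_rpow_le_rpow_sum _ hp fun i _ => mul_nonneg (hc k i) (hz i)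

/-- By definition of the level s, the left side equals s times the marginal cost. Young's inequality
on each row meeting column i returns a 1/p share of the left side, which is absorbed. -/
theorem colPow_mul_level_rpow_le (hp : 1 < p) (hc : ∀ k i, 0 ≤ c k i) {x : Fin n → ℝ}
    (hx : 0 ≤ x) (i : Fin n) :
    colPow c p i * level c p x i ^ p ≤ ∑ k, if c k i = 0 then 0 else load c x k ^ p := by
  set s := level c p x i with hs
  have hs0 : 0 ≤ s := level_nonneg hc hx i
  have hrhs : ∀ k, (0 : ℝ) ≤ if c k i = 0 then 0 else load c x k ^ p := fun k => by
    split_ifs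
    exacts [le_rfl, Real.rpow_nonneg (load_nonneg hc hx k) _]
  by_cases hi : ∃ k, c k i ≠ 0
  · have hC := colPow_pos (p := p) hc hi
    have h1 : s ^ (p - 1) = marginal c p x i / colPow c p i :=
      Real.rpow_inv_rpow (div_nonneg (marginal_nonneg hc hx i) hC.le) (by linarith)
    have h2 : colPow c p i * s ^ p = s * marginal c p x i := by
      have : s ^ p = s * s ^ (p - 1) := by
        rw [← Real.rpow_one_add' hs0 (by linarith)]; congr 1; ring
      rw [this, h1]; field_simp
    have h3 : s * marginal c p x i ≤ ∑ k, ((c k i ^ p * s ^ p) / p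
        + (1 - 1 / p) * if c k i = 0 then 0 else load c x k ^ p) := by
      rw [marginal, Finset.mul_sum]
      refine Finset.sum_le_sum fun k _ => ?_
      by_cases hk : c k i = 0
      · simp [hk, Real.zero_rpow (by linarith : p ≠ 0)]
      · rw [if_neg hk, ← Real.mul_rpow (hc k i) hs0, ← mul_assoc, mul_comm s]
        exact mul_rpow_sub_one_le hp (mul_nonneg (hc k i) hs0) (load_nonneg hc hx k)
    rw [Finset.sum_add_distrib, ← Finset.sum_div, ← Finset.sum_mul, ← Finset.mul_sum, ← h2] at h3
    have h4 : (1 - 1 / p) * (colPow c p i * s ^ p)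
        ≤ (1 - 1 / p) * ∑ k, if c k i = 0 then 0 else load c x k ^ p := by
      have : (1 - 1 / p) * (colPow c p i * s ^ p)
        = colPow c p i * s ^ p - colPow c p i * s ^ p / p := by ring
      rw [this, sub_le_iff_le_add']; exact h3
    refine le_of_mul_le_mul_left h4 ?_
    rw [sub_pos, div_lt_one (by linarith)]; exact hp
  · push Not at hi
    have : colPow c p i = 0 := by simp [colPow, hi, Real.zero_rpow (by linarith : p ≠ 0)]
    rw [this, zero_mul]
    exact Finset.sum_nonneg fun k _ => hrhs k

/-- The power-mean inequality on at most d terms costs d^(p-1), dividing the level by d gains d^p,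
and the remaining factor d pays for each row being counted once per nonzero column. -/
theorem powerCost_reserve_le (hp : 1 < p) (hc : ∀ k i, 0 ≤ c k i) {d : ℕ} (hd : 1 ≤ d)
    (hsp : ∀ k, (Function.support (c k)).ncard ≤ d) {x : Fin n → ℝ} (hx : 0 ≤ x) :
    powerCost c p (reserve c p d x) ≤ powerCost c p x := by
  classical
  have hd0 : (0 : ℝ) < d := by exact_mod_cast hd
  set S : Fin l → Finset (Fin n) := fun k => Finset.univ.filter fun i => c k i ≠ 0 with hS
  have hcard : ∀ k, ((S k).card : ℝ) ≤ d := fun k => by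
    have : (S k).card = (Function.support (c k)).ncard := by
      rw [← Set.ncard_coe_finset]; congr 1; ext i; simp [hS]
    exact_mod_cast this ▸ hsp k
  have h1 : ∀ k, load c (reserve c p d x) k ^ p
      ≤ (d : ℝ) ^ (p - 1) * ∑ i, c k i ^ p * reserve c p d x i ^ p := fun k => by
    have hr := reserve_nonneg (p := p) hc hd0.le hx
    have e1 : load c (reserve c p d x) k = ∑ i ∈ S k, |c k i * reserve c p d x i| := by
      have : load c (reserve c p d x) k = ∑ i, c k i * reserve c p d x i := rfl
      rw [this, ← Finset.sum_subset (Finset.subset_univ (S k))]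
      · exact Finset.sum_congr rfl fun i _ => (abs_of_nonneg (mul_nonneg (hc k i) (hr i))).symm
      · intro i _ hi
        have : c k i = 0 := by simpa [hS] using hi
        simp [this]
    rw [e1]
    refine (Real.rpow_sum_le_const_mul_sum_rpow (S k) _ hp.le).trans ?_
    refine mul_le_mul (Real.rpow_le_rpow (by positivity) (hcard k) (by linarith)) ?_
      (Finset.sum_nonneg fun i _ => by positivity) (by positivity)
    refine (Finset.sum_le_sum_of_subset_of_nonneg (Finset.subset_univ _)
      fun i _ _ => by positivity).trans (Finset.sum_le_sum fun i _ => ?_)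
    rw [abs_of_nonneg (mul_nonneg (hc k i) (hr i)), Real.mul_rpow (hc k i) (hr i)]
  have h2 : powerCost c p (reserve c p d x)
      ≤ (d : ℝ) ^ (p - 1) * ∑ i, colPow c p i * reserve c p d x i ^ p := by
    refine (Finset.sum_le_sum fun k _ => h1 k).trans ?_
    rw [← Finset.mul_sum, Finset.sum_comm]
    simp only [colPow, Finset.sum_mul, le_refl]
  have h3 : (d : ℝ) ^ (p - 1) * ∑ i, colPow c p i * reserve c p d x i ^ p
      = (d : ℝ)⁻¹ * ∑ i, colPow c p i * level c p x i ^ p := by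
    rw [Finset.mul_sum, Finset.mul_sum]
    refine Finset.sum_congr rfl fun i _ => ?_
    rw [reserve, Real.div_rpow (level_nonneg hc hx i) hd0.le]
    have : (d : ℝ) ^ p = (d : ℝ) ^ (p - 1) * d := by
      rw [← Real.rpow_add_one hd0.ne']; congr 1; ring
    rw [this]; field_simp
  have h4 : ∑ i, colPow c p i * level c p x i ^ p ≤ d * powerCost c p x := by
    refine (Finset.sum_le_sum fun i _ => colPow_mul_level_rpow_le hp hc hx i).trans ?_
    rw [Finset.sum_comm, powerCost, Finset.mul_sum]
    refine Finset.sum_le_sum fun k _ => ?_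
    have : ∑ i, (if c k i = 0 then 0 else load c x k ^ p) = (S k).card * load c x k ^ p := by
      rw [← nsmul_eq_mul, ← Finset.sum_const, hS, Finset.sum_filter]
      exact Finset.sum_congr rfl fun i _ => by split_ifs <;> simp_all
    rw [this]
    exact mul_le_mul_of_nonneg_right (hcard k) (Real.rpow_nonneg (load_nonneg hc hx k) _)
  rw [h3] at h2
  refine h2.trans ?_
  rw [inv_mul_le_iff₀ hd0]
  exact h4

theorem powerCost_add_reserve_le (hp : 1 < p) (hc : ∀ k i, 0 ≤ c k i) {d : ℕ} (hd : 1 ≤ d)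
    (hsp : ∀ k, (Function.support (c k)).ncard ≤ d) {x : Fin n → ℝ} (hx : 0 ≤ x) :
    powerCost c p (x + reserve c p d x) ≤ 2 ^ p * powerCost c p x := by
  have h1 : powerCost c p (x + reserve c p d x)
      ≤ 2 ^ (p - 1) * (powerCost c p x + powerCost c p (reserve c p d x)) := by
    simp only [powerCost, ← Finset.sum_add_distrib, Finset.mul_sum, load_add]
    refine Finset.sum_le_sum fun k _ => ?_
    have ha := load_nonneg hc hx k
    have hb := load_nonneg hc (reserve_nonneg (p := p) hc (Nat.cast_nonneg d) hx) k
    lift load c x k to NNReal using ha with a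
    lift load c (reserve c p d x) k to NNReal using hb with b
    exact_mod_cast NNReal.rpow_add_le_mul_rpow_add_rpow a b hp.le
  have h2 := powerCost_reserve_le hp hc hd hsp hx
  have h3 : (2 : ℝ) ^ p = 2 ^ (p - 1) * 2 := by
    rw [← Real.rpow_add_one (by norm_num)]; congr 1; ring
  calc _ ≤ _ := h1
    _ ≤ 2 ^ (p - 1) * (powerCost c p x + powerCost c p x) := by gcongr
    _ = _ := by rw [h3]; ring

end Cost

/-! ### One discrete step: the cost increase is paid by the potential. -/

section Step

variable {n l : ℕ} {c : Fin l → Fin n → ℝ} {p D : ℝ}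

theorem coordPot_zero (q D z u : ℝ) : coordPot q D 0 z 0 u = 0 := by
  simp [coordPot]

theorem colPow_eq_zero (hp : p ≠ 0) {i : Fin n} (hi : ¬ ∃ k, c k i ≠ 0) : colPow c p i = 0 := by
  push Not at hi
  simp [colPow, hi, Real.zero_rpow hp]

theorem potential_nonneg (hp : 2 ≤ p) (hD : 1 ≤ D) (hc : ∀ k i, 0 ≤ c k i) {x z : Fin n → ℝ}
    (hx : ∀ i, 0 < x i) (hz : 0 ≤ z) : 0 ≤ potential c p D x z := by
  refine Finset.sum_nonneg fun i _ => ?_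
  rcases (hz i).eq_or_lt with h | h
  · simp [← h]
  by_cases hi : ∃ k, c k i ≠ 0
  · exact mul_nonneg (hz i) (coordPot_nonneg (by linarith) hD (colPow_pos hc hi) h
      (marginal_pos hc hx hi) (le_add_of_nonneg_left (hx i).le))
  · rw [marginal_eq_zero hi, colPow_eq_zero (by linarith) hi, zero_mul, coordPot_zero, mul_zero]

theorem potential_le (hp : 2 ≤ p) (hD : 1 ≤ D) (hc : ∀ k i, 0 ≤ c k i) {x z : Fin n → ℝ}
    (hx : ∀ i, 0 < x i) (hz : 0 ≤ z) :
    potential c p D x z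
      ≤ Real.log (4 * D) * ∑ k, load c z k * load c x k ^ (p - 1) + powerCost c p z := by
  have hx0 : 0 ≤ x := fun i => (hx i).le
  have h : potential c p D x z
      ≤ ∑ i, (Real.log (4 * D) * (z i * marginal c p x i) + colPow c p i * z i ^ p) := by
    refine Finset.sum_le_sum fun i _ => ?_
    rcases (hz i).eq_or_lt with h | h
    · simp [← h, Real.zero_rpow (by linarith : p ≠ 0)]
    by_cases hi : ∃ k, c k i ≠ 0
    · have h1 := coordPot_le (q := p - 1) (by linarith) hD (colPow_pos (p := p) hc hi) h
        (marginal_pos (p := p) hc hx hi) (add_pos_of_pos_of_nonneg (hx i)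
          (reserve_nonneg (p := p) hc (by linarith : 0 ≤ D) hx0 i))
      have h2 : z i ^ p = z i ^ (p - 1) * z i := by
        rw [← Real.rpow_add_one h.ne']; congr 1; ring
      refine (mul_le_mul_of_nonneg_left h1 h.le).trans_eq ?_
      rw [h2]; ring
    · rw [marginal_eq_zero hi, colPow_eq_zero (by linarith) hi, zero_mul, coordPot_zero]
      simp
  rw [Finset.sum_add_distrib, ← Finset.mul_sum, sum_mul_marginal] at h
  linarith [sum_colPow_mul_rpow_le (by linarith : 1 ≤ p) hc hz]

/-- One step of size `η` of the algorithm on the request `a`. -/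
noncomputable def eulerStep (c : Fin l → Fin n → ℝ) (p D : ℝ) (a : Fin n → ℝ) (η : ℝ)
    (x : Fin n → ℝ) (i : Fin n) : ℝ :=
  x i + η * (a i * (x i + reserve c p D x i)) / marginal c p x i

theorem le_eulerStep (hc : ∀ k i, 0 ≤ c k i) (hD : 0 ≤ D) {a x : Fin n → ℝ} (ha : 0 ≤ a)
    (hx : 0 ≤ x) {η : ℝ} (hη : 0 ≤ η) : x ≤ eulerStep c p D a η x := fun i =>
  le_add_of_nonneg_right (div_nonneg (mul_nonneg hη (mul_nonneg (ha i)
    (add_nonneg (hx i) (reserve_nonneg hc hD hx i)))) (marginal_nonneg hc hx i))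

/-- The cost rises by at most 3pη because ⟨a, x + r⟩ ≤ 1, while the potential rises by at least η /
8. The bound on η keeps every increment below x i / p, so the discrete step behaves like the
continuous flow. -/
theorem powerCost_eulerStep_sub_le (hp : 2 ≤ p) (hD : 1 ≤ D) (hc : ∀ k i, 0 ≤ c k i)
    {a x : Fin n → ℝ} (ha : 0 ≤ a) (hfree : ∀ i, a i ≠ 0 → ∃ k, c k i ≠ 0)
    (hx : ∀ i, 0 < x i) (hcov : a ⬝ᵥ (x + reserve c p D x) ≤ 1) {η : ℝ} (hη : 0 ≤ η)
    (hη' : ∀ i, a i ≠ 0 → η ≤ x i * marginal c p x i / p) {z : Fin n → ℝ} (hz : 0 ≤ z)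
    (haz : 1 ≤ a ⬝ᵥ z) :
    powerCost c p (eulerStep c p D a η x) - powerCost c p x
      ≤ 24 * p * (potential c p D (eulerStep c p D a η x) z - potential c p D x z) := by
  have hp0 : 0 < p := by linarith
  have hD0 : 0 ≤ D := by linarith
  have hx0 : 0 ≤ x := fun i => (hx i).le
  set r := reserve c p D x with hr
  have hr0 : 0 ≤ r := reserve_nonneg hc hD0 hx0
  set y := eulerStep c p D a η x with hy
  have hxy : x ≤ y := le_eulerStep hc hD0 ha hx0 hη
  set δ : Fin n → ℝ := fun i => η * (a i * (x i + r i)) / marginal c p x i with hδ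
  have hyδ : y = x + δ := rfl
  have hδ0 : 0 ≤ δ := fun i => div_nonneg (mul_nonneg hη (mul_nonneg (ha i)
    (add_nonneg (hx i).le (hr0 i)))) (marginal_nonneg hc hx0 i)
  have hδ0' : ∀ i, (0 : ℝ) ≤ δ i := hδ0
  have hr0' : ∀ i, (0 : ℝ) ≤ r i := hr0
  have hz' : ∀ i, (0 : ℝ) ≤ z i := hz
  have hcov' : ∀ i, a i * (x i + r i) ≤ 1 := fun i =>
    (Finset.single_le_sum (f := fun i => a i * (x + r) i) (fun i _ => mul_nonneg (ha i)
      (add_nonneg (hx i).le (hr0 i))) (Finset.mem_univ i)).trans hcov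
  have hgδ : ∀ i, marginal c p x i * δ i = η * (a i * (x i + r i)) := fun i => by
    by_cases hi : a i = 0
    · simp [hδ, hi]
    · have := marginal_pos (p := p) hc hx (hfree i hi)
      simp only [hδ]; field_simp
  have hδx : ∀ i, δ i ≤ x i / p := fun i => by
    by_cases hi : a i = 0
    · simp only [hδ, hi, zero_mul, mul_zero, zero_div]; exact div_nonneg (hx i).le hp0.le
    · have hg := marginal_pos (p := p) hc hx (hfree i hi)
      refine le_of_mul_le_mul_left ?_ hg
      rw [hgδ]
      calc η * (a i * (x i + r i)) ≤ η * 1 := mul_le_mul_of_nonneg_left (hcov' i) hη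
        _ ≤ x i * marginal c p x i / p := by rw [mul_one]; exact hη' i hi
        _ = _ := by ring
  have hcost : powerCost c p y - powerCost c p x ≤ 3 * p * η := by
    have h1 : powerCost c p y - powerCost c p x
        ≤ ∑ k, 3 * p * (load c δ k * load c x k ^ (p - 1)) := by
      simp only [powerCost, ← Finset.sum_sub_distrib]
      refine Finset.sum_le_sum fun k _ => ?_
      rw [hyδ, load_add, mul_comm (load c δ k)]
      refine rpow_add_sub_rpow_le (by linarith) (load_nonneg hc hx0 k) (load_nonneg hc hδ0 k) ?_
      have : load c δ k ≤ load c (p⁻¹ • x) k := load_mono hc (fun i => by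
        simpa [div_eq_inv_mul] using hδx i) k
      rwa [load_smul, inv_mul_eq_div] at this
    rw [← Finset.mul_sum, ← sum_mul_marginal] at h1
    have h2 : ∑ i, δ i * marginal c p x i ≤ η := by
      have : ∑ i, δ i * marginal c p x i = η * (a ⬝ᵥ (x + r)) := by
        rw [dotProduct, Finset.mul_sum]
        exact Finset.sum_congr rfl fun i _ => by rw [mul_comm, hgδ]; rfl
      rw [this]
      exact mul_le_of_le_one_right hη hcov
    have h3 := mul_le_mul_of_nonneg_left h2 (by positivity : 0 ≤ 3 * p)
    linarith
  have hy2 : y ≤ (2 : ℝ) • x := fun i => by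
    have h1 : x i / p ≤ x i := div_le_self (hx i).le (by linarith)
    have h2 := hδx i
    have : y i = x i + δ i := rfl
    simp only [Pi.smul_apply, smul_eq_mul]; linarith
  -- Subtracting 3/4 of the online share makes the bound hold for truncated coordinates too; summed,
  -- it leaves η (1 - 3/4) / 2 = η / 8.
  have hgain : ∀ i, η * (a i * z i - 3 / 4 * (a i * (x i + r i))) / 2
      ≤ z i * coordPot (p - 1) D (colPow c p i * z i ^ (p - 1)) (z i) (marginal c p y i)
          (y i + reserve c p D y i)
        - z i * coordPot (p - 1) D (colPow c p i * z i ^ (p - 1)) (z i) (marginal c p x i)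
          (x i + r i) := fun i => by
    have hu0 : 0 < x i + r i := add_pos_of_pos_of_nonneg (hx i) (hr0 i)
    have hu1 : x i + r i + δ i ≤ y i + reserve c p D y i := by
      have h1 := reserve_mono (by linarith : 1 ≤ p) hc hD0 hx0 hxy i
      have : y i = x i + δ i := rfl
      linarith
    rcases (hz' i).eq_or_lt with h | h
    · have h1 : 0 ≤ η * (a i * (x i + r i)) := mul_nonneg hη (mul_nonneg (ha i) hu0.le)
      simp only [← h, mul_zero, zero_mul, sub_self, zero_sub]; linarith
    by_cases hi : ∃ k, c k i ≠ 0
    · have hg := marginal_pos (p := p) hc hx hi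
      have hgg := marginal_mono (by linarith : 1 ≤ p) hc hx0 hxy i
      have hg2 : marginal c p y i ≤ 2 ^ (p - 1) * marginal c p x i := by
        rw [← marginal_smul hc hx0 (by norm_num)]
        exact marginal_mono (by linarith) hc (hx0.trans hxy) hy2 i
      have h1 := coordPot_sub_ge (q := p - 1) (u₀ := x i + r i)
        (u₁ := y i + reserve c p D y i) (by linarith) hD
        (colPow_pos (p := p) hc hi) h hg hgg hg2 (le_add_of_nonneg_left (hx i).le :
          (marginal c p x i / colPow c p i) ^ (p - 1)⁻¹ / D ≤ x i + r i)
      rw [← mul_sub]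
      refine le_trans ?_ (mul_le_mul_of_nonneg_left h1 h.le)
      have hmin : 0 < min (x i + r i) (2 * z i) := lt_min hu0 (by positivity)
      have hlog : Real.log (min (x i + r i) (2 * z i))
          ≤ Real.log (min (y i + reserve c p D y i) (2 * z i)) :=
        Real.log_le_log hmin (min_le_min_right _ (by linarith [hδ0' i]))
      -- Below the truncation the logarithm gains at least δ / (2u), with u = x i + r i. Beyond it,
      -- δ ≤ u / 2 forces z ≤ 3u / 4, so no gain is needed.
      rcases le_or_gt (x i + r i + δ i) (2 * z i) with hrel | hrel
      · have hx2 : x i + r i ≤ 2 * z i := by linarith [hδ0' i]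
        have hlog2 : Real.log (x i + r i + δ i)
            ≤ Real.log (min (y i + reserve c p D y i) (2 * z i)) :=
          Real.log_le_log (by linarith [hδ0' i]) (le_min hu1 hrel)
        have hδu : δ i ≤ x i + r i := by
          have : x i / p ≤ x i := div_le_self (hx i).le (by linarith)
          linarith [hδx i, hr0' i]
        have hlog3 : δ i / (2 * (x i + r i))
            ≤ Real.log (x i + r i + δ i) - Real.log (x i + r i) := by
          have hu2 : 0 < x i + r i + δ i := by linarith [hδ0' i]
          have h2 := Real.log_le_sub_one_of_pos (div_pos hu0 hu2)
          rw [Real.log_div hu0.ne' hu2.ne'] at h2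
          have h3 : δ i / (2 * (x i + r i)) ≤ δ i / (x i + r i + δ i) :=
            div_le_div_of_nonneg_left (hδ0' i) hu2 (by linarith)
          have h4 : (x i + r i) / (x i + r i + δ i) - 1 = - (δ i / (x i + r i + δ i)) := by
            field_simp; ring
          linarith
        rw [min_eq_left hx2] at hlog ⊢
        have h5 : η * a i / 2 ≤ marginal c p y i
            * (Real.log (min (y i + reserve c p D y i) (2 * z i)) - Real.log (x i + r i)) := by
          calc η * a i / 2 = marginal c p x i * (δ i / (2 * (x i + r i))) := by
                rw [← mul_div_assoc, hgδ]; field_simp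
            _ ≤ marginal c p y i * (Real.log (min (y i + reserve c p D y i) (2 * z i))
                - Real.log (x i + r i)) := by
                apply mul_le_mul hgg (by linarith) (by have := hδ0' i; positivity)
                  (hg.le.trans hgg)
        have h6 := mul_le_mul_of_nonneg_left h5 h.le
        have h7 : 0 ≤ η * (a i * (x i + r i)) := mul_nonneg hη (mul_nonneg (ha i) hu0.le)
        linarith
      · have h2 : 0 ≤ marginal c p y i * (Real.log (min (y i + reserve c p D y i) (2 * z i))
            - Real.log (min (x i + r i) (2 * z i))) :=
          mul_nonneg (hg.le.trans hgg) (sub_nonneg.2 hlog)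
        refine le_trans ?_ (mul_nonneg h.le h2)
        have h3 : z i ≤ 3 / 4 * (x i + r i) := by
          have : x i / p ≤ x i / 2 := div_le_div_of_nonneg_left (hx i).le (by norm_num) hp
          linarith [hδx i, hr0' i]
        have h4 := mul_nonneg hη (mul_nonneg (ha i) (sub_nonneg.2 h3))
        linarith
    · have hai : a i = 0 := by
        by_contra h0
        exact hi (hfree i h0)
      rw [marginal_eq_zero hi, marginal_eq_zero hi, colPow_eq_zero hp0.ne' hi, zero_mul,
        coordPot_zero, coordPot_zero, hai]
      simp
  have hsum : η / 8 ≤ potential c p D y z - potential c p D x z := by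
    have h1 := Finset.sum_le_sum fun i (_ : i ∈ Finset.univ) => hgain i
    rw [Finset.sum_sub_distrib, ← Finset.sum_div, ← Finset.mul_sum, Finset.sum_sub_distrib,
      ← Finset.mul_sum] at h1
    have h2 : η * (1 / 4) ≤ η * (∑ i, a i * z i - 3 / 4 * ∑ i, a i * (x i + r i)) := by
      apply mul_le_mul_of_nonneg_left _ hη
      have e1 : a ⬝ᵥ z = ∑ i, a i * z i := rfl
      have e2 : a ⬝ᵥ (x + r) = ∑ i, a i * (x i + r i) := rfl
      linarith
    have h3 : potential c p D y z - potential c p D x z = _ := rfl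
    refine le_trans (by linarith) h1
  have := mul_le_mul_of_nonneg_left hsum (by positivity : 0 ≤ 24 * p)
  linarith

end Step

/-! ### Satisfying one request, and the final absorption. -/

section Cover

open Filter Topology

variable {n l : ℕ} {c : Fin l → Fin n → ℝ} {p D : ℝ}

/-- Repeating steps of one fixed size must terminate: until the request is covered ⟨a, x'⟩ stays
below 1, yet each step raises it by a fixed κ > 0. This is run as a contradiction with the supremum
of the reachable values. -/
theorem exists_le_covering (hp : 2 ≤ p) (hD : 1 ≤ D) (hc : ∀ k i, 0 ≤ c k i) {a x : Fin n → ℝ}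
    (ha : 0 ≤ a) (hfree : ∀ i, a i ≠ 0 → ∃ k, c k i ≠ 0) (hane : a ≠ 0) (hx : ∀ i, 0 < x i) :
    ∃ x', x ≤ x' ∧ 1 ≤ a ⬝ᵥ (x' + reserve c p D x') ∧ ∀ z, 0 ≤ z → 1 ≤ a ⬝ᵥ z →
      powerCost c p x' - powerCost c p x ≤ 24 * p * (potential c p D x' z - potential c p D x z) := by
  by_contra! hcon
  have hp0 : 0 < p := by linarith
  have hD0 : 0 ≤ D := by linarith
  have hall : ∀ x', x ≤ x' → (∀ z, 0 ≤ z → 1 ≤ a ⬝ᵥ z → powerCost c p x' - powerCost c p x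
      ≤ 24 * p * (potential c p D x' z - potential c p D x z)) →
      a ⬝ᵥ (x' + reserve c p D x') < 1 := fun x' h1 h2 => by
    by_contra! h3
    obtain ⟨z, hz, haz, h⟩ := hcon x' h1 h3
    exact absurd (h2 z hz haz) (not_le.2 h)
  have hx0 : 0 ≤ x := fun i => (hx i).le
  obtain ⟨j, hj⟩ : ∃ j, a j ≠ 0 := Function.ne_iff.1 hane
  have hpos : ∀ i, a i ≠ 0 → 0 < a i := fun i hi => lt_of_le_of_ne (ha i) (Ne.symm hi)
  obtain ⟨η, hη, hη0⟩ : ∃ η : ℝ, (∀ i, a i ≠ 0 → η ≤ x i * marginal c p x i / p) ∧ 0 < η := by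
    have h1 : ∀ᶠ η in 𝓝[>] (0 : ℝ), ∀ i, a i ≠ 0 → η ≤ x i * marginal c p x i / p := by
      refine eventually_all.2 fun i => ?_
      by_cases hi : a i = 0
      · exact Eventually.of_forall fun _ h => absurd hi h
      · have : 0 < x i * marginal c p x i / p :=
          div_pos (mul_pos (hx i) (marginal_pos hc hx (hfree i hi))) hp0
        filter_upwards [Ioc_mem_nhdsGT this] with η hη _ using hη.2
    exact (h1.and self_mem_nhdsWithin).exists
  -- An upper bound for every uncovered reachable vector; it caps the marginal cost at j and so
  -- makes κ uniform.
  set b : Fin n → ℝ := fun i => if a i = 0 then x i else (a i)⁻¹ with hb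
  have hbpos : ∀ i, 0 < b i := fun i => by
    simp only [hb]; split_ifs with h
    exacts [hx i, inv_pos.2 (hpos i h)]
  have hbj := marginal_pos (p := p) hc hbpos (hfree j hj)
  set κ := a j * (η * (a j * x j) / marginal c p b j) with hκ
  have hκ0 : 0 < κ := mul_pos (hpos j hj)
    (div_pos (mul_pos hη0 (mul_pos (hpos j hj) (hx j))) hbj)
  set T : Set ℝ := {t | ∃ x', x ≤ x' ∧ (∀ i, a i = 0 → x' i = x i) ∧
    (∀ z, 0 ≤ z → 1 ≤ a ⬝ᵥ z → powerCost c p x' - powerCost c p x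
      ≤ 24 * p * (potential c p D x' z - potential c p D x z)) ∧ a ⬝ᵥ x' = t} with hT
  have hle : ∀ x', x ≤ x' → a ⬝ᵥ x' ≤ a ⬝ᵥ (x' + reserve c p D x') := fun x' h => by
    rw [dotProduct_add]
    exact le_add_of_nonneg_right (Finset.sum_nonneg fun i _ =>
      mul_nonneg (ha i) (reserve_nonneg hc hD0 (hx0.trans h) i))
  have hTb : BddAbove T := ⟨1, by
    rintro t ⟨x', h1, -, h3, rfl⟩
    exact (hle x' h1).trans (hall x' h1 h3).le⟩
  have hTne : T.Nonempty := ⟨_, x, le_rfl, fun _ _ => rfl, fun z _ _ => by simp, rfl⟩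
  obtain ⟨t, ⟨x', h1, h2, h3, rfl⟩, ht⟩ := exists_lt_of_lt_csSup hTne (sub_lt_self (sSup T) hκ0)
  have hcov := hall x' h1 h3
  have hx' : ∀ i, 0 < x' i := fun i => (hx i).trans_le (h1 i)
  have hx'0 : 0 ≤ x' := fun i => (hx' i).le
  have hx'b : x' ≤ b := fun i => by
    simp only [hb]; split_ifs with h
    · exact (h2 i h).le
    · have h4 : a i * x' i ≤ a ⬝ᵥ x' := Finset.single_le_sum (f := fun i => a i * x' i)
        (fun i _ => mul_nonneg (ha i) (hx'0 i)) (Finset.mem_univ i)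
      have h5 := (h4.trans (hle x' h1)).trans hcov.le
      rwa [← one_div, le_div_iff₀' (hpos i h)]
  set y := eulerStep c p D a η x' with hy
  have hxy : x' ≤ y := le_eulerStep hc hD0 ha hx'0 hη0.le
  have hstep : ∀ z, 0 ≤ z → 1 ≤ a ⬝ᵥ z → powerCost c p y - powerCost c p x'
      ≤ 24 * p * (potential c p D y z - potential c p D x' z) := fun z hz haz => by
    refine powerCost_eulerStep_sub_le hp hD hc ha hfree hx' hcov.le hη0.le (fun i hi => ?_) hz haz
    refine (hη i hi).trans (div_le_div_of_nonneg_right (mul_le_mul (h1 i)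
      (marginal_mono (by linarith) hc hx0 h1 i) (marginal_nonneg hc hx0 i) (hx' i).le) hp0.le)
  have hyT : a ⬝ᵥ y ∈ T := by
    refine ⟨y, h1.trans hxy, fun i hi => ?_, fun z hz haz => ?_, rfl⟩
    · simp [hy, eulerStep, hi, h2 i hi]
    · have := h3 z hz haz
      have := hstep z hz haz
      linarith
  have hinc : a ⬝ᵥ x' + κ ≤ a ⬝ᵥ y := by
    have e1 : a ⬝ᵥ y = a ⬝ᵥ x'
        + ∑ i, a i * (η * (a i * (x' i + reserve c p D x' i)) / marginal c p x' i) := by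
      simp only [dotProduct, ← Finset.sum_add_distrib]
      exact Finset.sum_congr rfl fun i _ => by simp only [hy, eulerStep]; ring
    have hr : ∀ i, (0 : ℝ) ≤ reserve c p D x' i := reserve_nonneg hc hD0 hx'0
    have hg : ∀ i, (0 : ℝ) ≤ marginal c p x' i := marginal_nonneg hc hx'0
    have ha' : ∀ i, (0 : ℝ) ≤ a i := ha
    have h4 : a j * (η * (a j * (x' j + reserve c p D x' j)) / marginal c p x' j)
        ≤ ∑ i, a i * (η * (a i * (x' i + reserve c p D x' i)) / marginal c p x' i) :=
      Finset.single_le_sum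
        (f := fun i => a i * (η * (a i * (x' i + reserve c p D x' i)) / marginal c p x' i))
        (fun i _ => by have := hr i; have := hg i; have := ha' i; have := (hx' i).le; positivity)
        (Finset.mem_univ j)
    have h5 : κ ≤ a j * (η * (a j * (x' j + reserve c p D x' j)) / marginal c p x' j) := by
      have hgj := marginal_pos (p := p) hc hx' (hfree j hj)
      have h6 := marginal_mono (by linarith : 1 ≤ p) hc hx'0 hx'b j
      have h7 : x j ≤ x' j + reserve c p D x' j := (h1 j).trans (le_add_of_nonneg_right (hr j))
      have := hpos j hj
      have := (hx j).le
      have : 0 ≤ x' j + reserve c p D x' j := this.trans h7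
      rw [hκ]
      gcongr
    linarith
  linarith [le_csSup hTb hyT]

/-- The logarithms need a positive start. Any z meeting the request has some a i * z i ≥ 1 / n,
which forces a positive cost independent of z; a small multiple of the all-ones vector costs less.
-/
theorem exists_pos_powerCost_le (hp : 2 ≤ p) (hc : ∀ k i, 0 ≤ c k i) {a : Fin n → ℝ}
    (ha : 0 ≤ a) (hfree : ∀ i, a i ≠ 0 → ∃ k, c k i ≠ 0) :
    ∃ x : Fin n → ℝ, (∀ i, 0 < x i) ∧ ∀ z, 0 ≤ z → 1 ≤ a ⬝ᵥ z → powerCost c p x ≤ powerCost c p z := by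
  have hp0 : 0 < p := by linarith
  have hscale : ∀ ε : ℝ, 0 < ε → powerCost c p (ε • 1) = ε ^ p * powerCost c p 1 := fun ε hε => by
    simp only [powerCost, load_smul, Finset.mul_sum]
    exact Finset.sum_congr rfl fun k _ =>
      Real.mul_rpow hε.le (load_nonneg hc (fun _ => zero_le_one) k)
  have hlim : Tendsto (fun ε : ℝ => ε ^ p * powerCost c p 1) (𝓝[>] 0) (𝓝 0) := by
    have h1 : Continuous fun ε : ℝ => ε ^ p * powerCost c p 1 :=
      (Real.continuous_rpow_const hp0.le).mul continuous_const
    have h2 := h1.tendsto 0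
    simp only [Real.zero_rpow hp0.ne', zero_mul] at h2
    exact h2.mono_left nhdsWithin_le_nhds
  have hev : ∀ᶠ ε in 𝓝[>] (0 : ℝ), ∀ i k, a i ≠ 0 → c k i ≠ 0 →
      ε ^ p * powerCost c p 1 ≤ (c k i / (n * a i)) ^ p := by
    refine eventually_all.2 fun i => eventually_all.2 fun k => ?_
    by_cases h : a i ≠ 0 ∧ c k i ≠ 0
    · have hn : (0 : ℝ) < n := by exact_mod_cast i.pos
      have h1 : 0 < a i := lt_of_le_of_ne (ha i) (Ne.symm h.1)
      have h2 : 0 < c k i := lt_of_le_of_ne (hc k i) (Ne.symm h.2)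
      filter_upwards [hlim.eventually_le_const
        (by positivity : 0 < (c k i / (n * a i)) ^ p)] with ε hε _ _ using hε
    · exact Eventually.of_forall fun _ h1 h2 => absurd ⟨h1, h2⟩ h
  obtain ⟨ε, hε, hε0⟩ := (hev.and self_mem_nhdsWithin).exists
  have hε0 : 0 < ε := hε0
  refine ⟨ε • 1, fun i => by simpa using hε0, fun z hz haz => ?_⟩
  obtain ⟨i, hi⟩ : ∃ i, 1 ≤ n * (a i * z i) := by
    by_contra! h
    rcases Nat.eq_zero_or_pos n with rfl | hn
    · simp at haz; linarith
    have : Nonempty (Fin n) := ⟨⟨0, hn⟩⟩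
    have h1 := Finset.sum_lt_sum_of_nonempty Finset.univ_nonempty fun i (_ : i ∈ Finset.univ) => h i
    rw [← Finset.mul_sum] at h1
    simp only [Finset.sum_const, Finset.card_univ, Fintype.card_fin, nsmul_eq_mul, mul_one] at h1
    have h2 : (n : ℝ) * 1 ≤ n * (a ⬝ᵥ z) := mul_le_mul_of_nonneg_left haz (Nat.cast_nonneg n)
    have e : a ⬝ᵥ z = ∑ i, a i * z i := rfl
    rw [e] at h2
    linarith
  have hai : a i ≠ 0 := fun h => by rw [h] at hi; simp at hi; linarith
  obtain ⟨k, hk⟩ := hfree i hai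
  rw [hscale ε hε0]
  refine (hε i k hai hk).trans ?_
  have hn : (0 : ℝ) < n := by exact_mod_cast i.pos
  have h1 : 0 < a i := lt_of_le_of_ne (ha i) (Ne.symm hai)
  have h2 : c k i / (n * a i) ≤ load c z k := by
    refine le_trans ?_ (mul_le_load hc hz k i)
    rw [div_le_iff₀ (by positivity)]
    have := mul_le_mul_of_nonneg_left hi (hc k i)
    linarith
  have h3 : 0 ≤ c k i / (n * a i) := div_nonneg (hc k i) (by positivity)
  exact (Real.rpow_le_rpow h3 h2 hp0.le).trans (Finset.single_le_sum
    (f := fun k => load c z k ^ p) (fun k _ => Real.rpow_nonneg (load_nonneg hc hz k) _)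
    (Finset.mem_univ k))

/-- Young's inequality with weight M on z leaves F / p on the left, so F ≤ (p + 24p² + M^p) O. As M
≥ 48p, this is at most 2 M^p O ≤ (2M)^p O. -/
theorem powerCost_le_of_le_potential (hp : 2 ≤ p) (hD : 2 ≤ D) (hc : ∀ k i, 0 ≤ c k i)
    {x z : Fin n → ℝ} (hx : ∀ i, 0 < x i) (hz : 0 ≤ z)
    (h : powerCost c p x ≤ powerCost c p z + 24 * p * potential c p D x z) :
    powerCost c p x ≤ (2 * (24 * p * Real.log (4 * D))) ^ p * powerCost c p z := by
  have hp0 : 0 < p := by linarith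
  have hx0 : 0 ≤ x := fun i => (hx i).le
  set M := 24 * p * Real.log (4 * D) with hM
  set F := powerCost c p x
  set O := powerCost c p z with hO
  have hO0 : 0 ≤ O := powerCost_nonneg hc hz
  have hlog : 2 ≤ Real.log (4 * D) := by
    have h8 : Real.log 8 = 3 * Real.log 2 := by
      rw [show (8 : ℝ) = 2 ^ 3 by norm_num, Real.log_pow]; norm_num
    have := Real.log_le_log (by norm_num) (by linarith : (8 : ℝ) ≤ 4 * D)
    linarith [Real.log_two_gt_d9]
  have hM48 : 48 * p ≤ M := by
    rw [hM]; nlinarith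
  have hpot := potential_le (D := D) hp (by linarith) hc hx hz
  have hy : M * ∑ k, load c z k * load c x k ^ (p - 1) ≤ M ^ p * O / p + (1 - 1 / p) * F := by
    have e : M ^ p * O / p + (1 - 1 / p) * F
        = ∑ k, ((M * load c z k) ^ p / p + (1 - 1 / p) * load c x k ^ p) := by
      rw [Finset.sum_add_distrib, ← Finset.sum_div, ← Finset.mul_sum, hO, powerCost, Finset.mul_sum]
      congr 2
      exact Finset.sum_congr rfl fun k _ =>
        (Real.mul_rpow (by linarith) (load_nonneg hc hz k)).symm
    rw [e, Finset.mul_sum]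
    refine Finset.sum_le_sum fun k _ => ?_
    rw [← mul_assoc]
    exact mul_rpow_sub_one_le (by linarith) (mul_nonneg (by linarith) (load_nonneg hc hz k))
      (load_nonneg hc hx0 k)
  have h1 : F ≤ O + (M ^ p * O / p + (1 - 1 / p) * F) + 24 * p * O := by
    have := mul_le_mul_of_nonneg_left hpot (by positivity : 0 ≤ 24 * p)
    have e : 24 * p * (Real.log (4 * D) * ∑ k, load c z k * load c x k ^ (p - 1) + O)
      = M * ∑ k, load c z k * load c x k ^ (p - 1) + 24 * p * O := by rw [hM]; ring
    linarith
  have h2 : F ≤ (p + 24 * p ^ 2 + M ^ p) * O := by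
    have h3 : F / p ≤ (1 + 24 * p + M ^ p / p) * O := by
      have e1 : (1 - 1 / p) * F = F - F / p := by ring
      have e2 : M ^ p * O / p = M ^ p / p * O := by ring
      rw [e1, e2] at h1
      linarith
    rw [div_le_iff₀ hp0] at h3
    refine h3.trans_eq ?_
    field_simp
  refine h2.trans (mul_le_mul_of_nonneg_right ?_ hO0)
  have hM1 : 1 ≤ M := by linarith
  have h4 : M ^ (2 : ℝ) ≤ M ^ p := Real.rpow_le_rpow_of_exponent_le hM1 hp
  rw [Real.rpow_two] at h4
  have h5 : p + 24 * p ^ 2 ≤ M ^ 2 := by nlinarith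
  have h6 : (2 : ℝ) ≤ 2 ^ p := by
    have := Real.rpow_le_rpow_of_exponent_le (by norm_num : (1 : ℝ) ≤ 2) (by linarith : 1 ≤ p)
    simpa using this
  rw [Real.mul_rpow (x := 2) (y := M) (by norm_num) (by linarith)]
  have h7 : 0 ≤ M ^ p := Real.rpow_nonneg (by linarith) _
  have h8 := mul_le_mul_of_nonneg_right h6 h7
  linarith

end Cover

/-! ### The online algorithm, and the passage from power sums to norms. -/

section Online

variable {n l : ℕ} {c : Fin l → Fin n → ℝ} {p : ℝ}

theorem exists_algorithm_of_invariant {n : ℕ} (Inv : List (Request n) → (Fin n → ℝ) → Prop)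
    (h0 : Inv [] 0) (hstep : ∀ as y a, Inv as y →
      ∃ y', Inv (as ++ [a]) y' ∧ y ≤ y' ∧ Request.SatisfiedBy a y') :
    ∃ A : Algorithm n, ∀ as, Inv as (A.assign as) := by
  choose! next h1 h2 h3 using hstep
  let run : List (Request n) → List (Request n) × (Fin n → ℝ) :=
    List.foldl (fun s a => (s.1 ++ [a], next s.1 s.2 a)) ([], 0)
  have run_concat : ∀ as a, run (as ++ [a]) = ((run as).1 ++ [a], next (run as).1 (run as).2 a) :=
    fun as a => by simp [run, List.foldl_append]
  have hrun : ∀ as, (run as).1 = as ∧ Inv as (run as).2 := fun as => by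
    induction as using List.reverseRecOn with
    | nil => exact ⟨rfl, h0⟩
    | append_singleton as a ih =>
      rw [run_concat, ih.1]
      exact ⟨rfl, h1 as _ a ih.2⟩
  refine ⟨⟨fun as => (run as).2, rfl, fun as a => ?_, fun as a => ?_⟩, fun as => (hrun as).2⟩
  · have := h2 as _ a (hrun as).2
    simpa only [run_concat, (hrun as).1] using this
  · have := h3 as _ a (hrun as).2
    simpa only [run_concat, (hrun as).1] using this

theorem feasible_nonempty {n : ℕ} (as : List (Request n)) : (feasible as).Nonempty := by
  induction as with
  | nil => exact ⟨0, le_rfl, by simp⟩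
  | cons a as ih =>
    obtain ⟨z, hz, hs⟩ := ih
    obtain ⟨i, hi⟩ : ∃ i, a.val i ≠ 0 := Function.ne_iff.1 a.2.2
    have hi' : 0 < a.val i := lt_of_le_of_ne (a.2.1 i) (Ne.symm hi)
    have hw : (0 : Fin n → ℝ) ≤ Pi.single i (a.val i)⁻¹ := Pi.single_nonneg.2 (inv_nonneg.2 hi'.le)
    have hnn : ∀ (b : Request n) (w : Fin n → ℝ), 0 ≤ w → 0 ≤ b.val ⬝ᵥ w := fun b w hw =>
      Finset.sum_nonneg fun i _ => mul_nonneg (b.2.1 i) (hw i)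
    refine ⟨z + Pi.single i (a.val i)⁻¹, add_nonneg hz hw, fun b hb => ?_⟩
    rw [Request.SatisfiedBy, dotProduct_add]
    rcases List.mem_cons.1 hb with rfl | hb
    · rw [dotProduct_single, mul_inv_cancel₀ hi]
      linarith [hnn b z hz]
    · have := hs b hb
      rw [Request.SatisfiedBy] at this
      linarith [hnn b _ hw]

theorem Algorithm.assign_nonneg {n : ℕ} (A : Algorithm n) (as : List (Request n)) :
    0 ≤ A.assign as := by
  induction as using List.reverseRecOn with
  | nil => exact A.assign_nil.ge
  | append_singleton as a ih => exact ih.trans (A.le_assign_concat as a)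

/-- Removes the infimum: the analysis compares with each feasible z separately. -/
theorem Algorithm.isCompetitive_iff {n : ℕ} (A : Algorithm n) {f : (Fin n → ℝ) → ℝ} {α : ℝ}
    (hα : 0 ≤ α) (hf : ∀ z, 0 ≤ z → 0 ≤ f z) :
    A.IsCompetitive f α ↔ ∀ as, ∀ z ∈ feasible as, f (A.assign as) ≤ α * f z := by
  refine forall_congr' fun as => ⟨fun h z hz => h.trans ?_, fun h => ?_⟩
  · refine mul_le_mul_of_nonneg_left (csInf_le ⟨0, ?_⟩ ⟨z, hz, rfl⟩) hα
    rintro _ ⟨w, hw, rfl⟩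
    exact hf w hw.1
  · have hne := (feasible_nonempty as).image f
    rcases hα.eq_or_lt with rfl | hα
    · obtain ⟨z, hz⟩ := feasible_nonempty as
      simpa using h z hz
    · rw [← div_le_iff₀' hα]
      refine le_csInf hne ?_
      rintro _ ⟨z, hz, rfl⟩
      rw [div_le_iff₀' hα]
      exact h z hz

theorem normCost_nonneg (q : ℝ≥0∞) [Fact (1 ≤ q)] (x : Fin n → ℝ) : 0 ≤ normCost c q x :=
  norm_nonneg _

theorem normCost_rpow (hp : 2 ≤ p) (hc : ∀ k i, 0 ≤ c k i) {x : Fin n → ℝ} (hx : 0 ≤ x) :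
    0 ≤ normCost c (ENNReal.ofReal p) x ∧
      normCost c (ENNReal.ofReal p) x ^ p = powerCost c p x := by
  have hp0 : 0 < p := by linarith
  have h1 : normCost c (ENNReal.ofReal p) x = powerCost c p x ^ (1 / p) := by
    rw [normCost, PiLp.norm_eq_sum (by rw [ENNReal.toReal_ofReal hp0.le]; exact hp0),
      ENNReal.toReal_ofReal hp0.le, powerCost]
    congr 1
    exact Finset.sum_congr rfl fun k _ => by
      rw [Real.norm_of_nonneg (load_nonneg hc hx k)]
  have h0 := powerCost_nonneg (p := p) hc hx
  refine ⟨h1 ▸ Real.rpow_nonneg h0 _, ?_⟩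
  rw [h1, one_div, Real.rpow_inv_rpow h0 hp0.ne']

theorem isCompetitive_powerCost_iff (hp : 2 ≤ p) (hc : ∀ k i, 0 ≤ c k i) (A : Algorithm n)
    {r : ℝ} (hr : 0 ≤ r) :
    A.IsCompetitive (powerCost c p) (r ^ p) ↔
      A.IsCompetitive (normCost c (ENNReal.ofReal p)) r := by
  rw [A.isCompetitive_iff (Real.rpow_nonneg hr p) fun z hz => powerCost_nonneg hc hz,
    A.isCompetitive_iff hr fun z hz => (normCost_rpow hp hc hz).1]
  refine forall_congr' fun as => forall_congr' fun z => forall_congr' fun hz => ?_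
  obtain ⟨h1, h2⟩ := normCost_rpow hp hc (A.assign_nonneg as)
  obtain ⟨h3, h4⟩ := normCost_rpow hp hc hz.1
  rw [← h2, ← h4, ← Real.mul_rpow hr h3, Real.rpow_le_rpow_iff h1 (mul_nonneg hr h3) (by linarith)]

/-- What the algorithm guarantees about its vector `y` after the requests `as`: the resources
that carry cost are either unused, or determined by a vector `x` whose cost is bounded by the
potential. -/
def Invariant (c : Fin l → Fin n → ℝ) (p D : ℝ) (as : List (Request n)) (y : Fin n → ℝ) : Prop :=
  0 ≤ y ∧ ((∀ i, (∃ k, c k i ≠ 0) → y i = 0) ∨ ∃ x : Fin n → ℝ, (∀ i, 0 < x i) ∧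
    (∀ i, (∃ k, c k i ≠ 0) → y i = x i + reserve c p D x i) ∧
    ∀ z ∈ feasible as, powerCost c p x ≤ powerCost c p z + 24 * p * potential c p D x z)

theorem feasible_append_subset (as bs : List (Request n)) : feasible (as ++ bs) ⊆ feasible as :=
  fun _ hz => ⟨hz.1, fun b hb => hz.2 b (List.mem_append_left _ hb)⟩

/-- If the request involves a resource of zero cost, that resource alone satisfies it and x is
unchanged. Otherwise x is created on first use, or kept, and then grown until x plus its reserve
covers the request. -/
theorem Invariant.exists_concat {D : ℝ} (hp : 2 ≤ p) (hD : 1 ≤ D) (hc : ∀ k i, 0 ≤ c k i)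
    {as : List (Request n)} {y : Fin n → ℝ} (hy : Invariant c p D as y) (a : Request n) :
    ∃ y', Invariant c p D (as ++ [a]) y' ∧ y ≤ y' ∧ a.SatisfiedBy y' := by
  classical
  have hD0 : 0 ≤ D := by linarith
  obtain ⟨hy0, hinv⟩ := hy
  by_cases hfree : ∀ i, a.val i ≠ 0 → ∃ k, c k i ≠ 0
  · obtain ⟨x₁, hx₁, hyx, hpot⟩ : ∃ x₁ : Fin n → ℝ, (∀ i, 0 < x₁ i) ∧
        (∀ i, (∃ k, c k i ≠ 0) → y i ≤ x₁ i + reserve c p D x₁ i) ∧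
        ∀ z ∈ feasible (as ++ [a]),
          powerCost c p x₁ ≤ powerCost c p z + 24 * p * potential c p D x₁ z := by
      rcases hinv with h | ⟨x, hx, hyx, hpot⟩
      · obtain ⟨x₀, hx₀, h₀⟩ := exists_pos_powerCost_le hp hc a.2.1 hfree
        refine ⟨x₀, hx₀, fun i hi => ?_, fun z hz => ?_⟩
        · rw [h i hi]
          exact add_nonneg (hx₀ i).le (reserve_nonneg hc hD0 (fun i => (hx₀ i).le) i)
        · have h1 := h₀ z hz.1 (hz.2 a (by simp))
          have h2 := mul_nonneg (by linarith : 0 ≤ 24 * p)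
            (potential_nonneg hp hD hc hx₀ hz.1)
          linarith
      · exact ⟨x, hx, fun i hi => (hyx i hi).le,
          fun z hz => hpot z (feasible_append_subset _ _ hz)⟩
    obtain ⟨x', hxx', hcov, hx'⟩ := exists_le_covering (D := D) hp hD hc a.2.1 hfree a.2.2 hx₁
    have hx₁0 : 0 ≤ x₁ := fun i => (hx₁ i).le
    have hx'p : ∀ i, 0 < x' i := fun i => (hx₁ i).trans_le (hxx' i)
    set y' : Fin n → ℝ := fun i => if ∃ k, c k i ≠ 0 then x' i + reserve c p D x' i else y i with hy'
    have hyy' : y ≤ y' := fun i => by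
      simp only [hy']; split_ifs with hi
      · exact (hyx i hi).trans (add_le_add (hxx' i) (reserve_mono (by linarith) hc hD0 hx₁0 hxx' i))
      · exact le_rfl
    refine ⟨y', ⟨hy0.trans hyy', Or.inr ⟨x', hx'p, fun i hi => by simp only [hy', if_pos hi],
      fun z hz => ?_⟩⟩, hyy', ?_⟩
    · have h1 := hpot z hz
      have h2 := hx' z hz.1 (hz.2 a (by simp))
      linarith
    · have : a.val ⬝ᵥ y' = a.val ⬝ᵥ (x' + reserve c p D x') := by
        refine Finset.sum_congr rfl fun i _ => ?_
        by_cases hi : a.val i = 0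
        · simp [hi]
        · simp only [hy', if_pos (hfree i hi), Pi.add_apply]
      rw [Request.SatisfiedBy, this]
      exact hcov
  · push Not at hfree
    obtain ⟨j, hj, hcj⟩ := hfree
    have hj' : 0 < a.val j := lt_of_le_of_ne (a.2.1 j) (Ne.symm hj)
    set y' := Function.update y j (max (y j) (a.val j)⁻¹) with hy'
    have hyy' : y ≤ y' := by
      rw [hy', le_update_iff]
      exact ⟨le_max_left _ _, fun _ _ => le_rfl⟩
    have hsame : ∀ i, (∃ k, c k i ≠ 0) → y' i = y i := fun i ⟨k, hk⟩ => by
      refine Function.update_of_ne ?_ _ _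
      rintro rfl
      exact hk (hcj k)
    refine ⟨y', ⟨hy0.trans hyy', ?_⟩, hyy', ?_⟩
    · rcases hinv with h | ⟨x, hx, hyx, hpot⟩
      · exact Or.inl fun i hi => (hsame i hi).trans (h i hi)
      · exact Or.inr ⟨x, hx, fun i hi => (hsame i hi).trans (hyx i hi),
          fun z hz => hpot z (feasible_append_subset _ _ hz)⟩
    · have h1 : a.val j * y' j ≤ a.val ⬝ᵥ y' := Finset.single_le_sum
        (f := fun i => a.val i * y' i) (fun i _ => mul_nonneg (a.2.1 i) (hy0.trans hyy' i))
        (Finset.mem_univ j)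
      refine le_trans ?_ h1
      rw [hy', Function.update_self]
      calc (1 : ℝ) = a.val j * (a.val j)⁻¹ := (mul_inv_cancel₀ hj).symm
        _ ≤ _ := mul_le_mul_of_nonneg_left (le_max_right _ _) hj'.le

theorem Invariant.powerCost_le (hp : 2 ≤ p) (hc : ∀ k i, 0 ≤ c k i) {d : ℕ} (hd : 2 ≤ d)
    (hsp : ∀ k, (Function.support (c k)).ncard ≤ d) {as : List (Request n)} {y : Fin n → ℝ}
    (hy : Invariant c p d as y) {z : Fin n → ℝ} (hz : z ∈ feasible as) :
    powerCost c p y ≤ (288 * (p * Real.log d)) ^ p * powerCost c p z := by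
  have hp0 : 0 < p := by linarith
  have hd2 : (2 : ℝ) ≤ d := by exact_mod_cast hd
  have hlogd : 0 < Real.log d := Real.log_pos (by linarith)
  have hO := powerCost_nonneg (p := p) hc hz.1
  obtain ⟨-, h | ⟨x, hx, hyx, hpot⟩⟩ := hy
  · have : powerCost c p y = 0 := by
      have : load c y = load c 0 := load_congr fun i hi => by simpa using h i hi
      have h2 : ∀ k, load c 0 k = 0 := fun k => dotProduct_zero _
      simp [powerCost, this, h2, Real.zero_rpow hp0.ne']
    rw [this]
    positivity
  · have h1 : powerCost c p y = powerCost c p (x + reserve c p d x) := by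
      have : load c y = load c (x + reserve c p d x) := load_congr hyx
      simp [powerCost, this]
    have h2 := powerCost_add_reserve_le (p := p) (by linarith) hc (by linarith : 1 ≤ d) hsp
      (fun i => (hx i).le)
    have h3 := powerCost_le_of_le_potential hp hd2 hc hx hz.1 (hpot z hz)
    have hlog : Real.log (4 * d) ≤ 3 * Real.log d := by
      rw [Real.log_mul (by norm_num) (by linarith), show (4 : ℝ) = 2 ^ 2 by norm_num, Real.log_pow]
      have := Real.log_le_log (by norm_num) hd2
      push_cast; linarith
    have hlog0 : 0 ≤ Real.log (4 * d) := Real.log_nonneg (by linarith)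
    -- 288 = 2 · 2 · 24 · 3: reserve, absorption, step constant, and log(4d) ≤ 3 log d.
    have h4 : (2 : ℝ) ^ p * (2 * (24 * p * Real.log (4 * d))) ^ p
        ≤ (288 * (p * Real.log d)) ^ p := by
      rw [← Real.mul_rpow (by norm_num) (by positivity)]
      refine Real.rpow_le_rpow (by positivity) ?_ hp0.le
      have := mul_le_mul_of_nonneg_left hlog hp0.le
      linarith
    calc powerCost c p y ≤ 2 ^ p * powerCost c p x := h1 ▸ h2
      _ ≤ 2 ^ p * ((2 * (24 * p * Real.log (4 * d))) ^ p * powerCost c p z) := by gcongr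
      _ ≤ _ := by rw [← mul_assoc]; exact mul_le_mul_of_nonneg_right h4 hO

theorem exists_isCompetitive_powerCost (hp : 2 ≤ p) (hc : ∀ k i, 0 ≤ c k i) {d : ℕ} (hd : 2 ≤ d)
    (hsp : ∀ k, (Function.support (c k)).ncard ≤ d) :
    ∃ A : Algorithm n, A.IsCompetitive (powerCost c p) ((288 * (p * Real.log d)) ^ p) := by
  have hd2 : (2 : ℝ) ≤ d := by exact_mod_cast hd
  obtain ⟨A, hA⟩ := exists_algorithm_of_invariant (Invariant c p d)
    ⟨le_rfl, Or.inl fun _ _ => rfl⟩ fun as y a hy => hy.exists_concat hp (by linarith) hc a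
  have hlogd : 0 ≤ Real.log d := Real.log_nonneg (by linarith)
  refine ⟨A, (A.isCompetitive_iff (by positivity) fun z hz => powerCost_nonneg hc hz).2 ?_⟩
  exact fun as z hz => (hA as).powerCost_le hp hc hd hsp hz

theorem exists_isCompetitive_normCost_top (hc : ∀ k i, 0 ≤ c k i) {d : ℕ} (hd : 2 ≤ d)
    (hl : 2 ≤ l) (hsp : ∀ k, (Function.support (c k)).ncard ≤ d) :
    ∃ A : Algorithm n, A.IsCompetitive (normCost c ⊤) (2592 * (Real.log l * Real.log d)) := by
  have hl2 : (2 : ℝ) ≤ l := by exact_mod_cast hl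
  have hd2 : (2 : ℝ) ≤ d := by exact_mod_cast hd
  have hlogl : Real.log 2 ≤ Real.log l := Real.log_le_log (by norm_num) hl2
  have hlog2 := Real.log_two_gt_d9
  have hlogd : 0 ≤ Real.log d := Real.log_nonneg (by linarith)
  -- The exponent 3 log l is at least 2 already for l = 2, and l ≤ 3^p makes the loss from sum to
  -- maximum a factor 3; hence 2592 = 288 · 3 · 3.
  have hp : 2 ≤ 3 * Real.log l := by linarith
  obtain ⟨A, hA⟩ := exists_isCompetitive_powerCost (c := c) hp hc hd hsp
  refine ⟨A, ?_⟩
  set p := 3 * Real.log l with hpdef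
  have hp0 : 0 < p := by linarith
  rw [A.isCompetitive_iff (by positivity) fun z hz => powerCost_nonneg hc hz] at hA
  have hnorm : ∀ x, normCost c ⊤ x = ‖load c x‖ := fun x => PiLp.norm_toLp _
  rw [A.isCompetitive_iff (mul_nonneg (by norm_num) (mul_nonneg (by linarith) hlogd))
    fun z _ => normCost_nonneg _ z]
  intro as z hz
  rw [hnorm, hnorm]
  set S := ‖load c z‖ with hS
  have hS0 : 0 ≤ S := norm_nonneg _
  have hle : powerCost c p z ≤ l * S ^ p := by
    have : ∑ k : Fin l, S ^ p = l * S ^ p := by simp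
    rw [← this]
    refine Finset.sum_le_sum fun k _ => Real.rpow_le_rpow (load_nonneg hc hz.1 k) ?_ hp0.le
    exact (le_abs_self _).trans (norm_le_pi_norm (load c z) k)
  have hexp : (l : ℝ) ≤ 3 ^ p := by
    rw [Real.rpow_def_of_pos (by norm_num), ← Real.log_le_iff_le_exp (by linarith)]
    have : 1 ≤ Real.log 3 := by
      rw [Real.le_log_iff_exp_le (by norm_num)]; linarith [Real.exp_one_lt_d9]
    nlinarith
  have hB0 : 0 ≤ 288 * (p * Real.log d) := by positivity
  refine (pi_norm_le_iff_of_nonneg (by positivity)).2 fun k => ?_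
  have hk := load_nonneg hc (A.assign_nonneg as) k
  rw [Real.norm_of_nonneg hk]
  have h1 : load c (A.assign as) k ^ p ≤ (288 * (p * Real.log d) * (3 * S)) ^ p := by
    calc load c (A.assign as) k ^ p ≤ powerCost c p (A.assign as) := Finset.single_le_sum
          (f := fun k => load c (A.assign as) k ^ p)
          (fun k _ => Real.rpow_nonneg (load_nonneg hc (A.assign_nonneg as) k) _)
          (Finset.mem_univ k)
      _ ≤ (288 * (p * Real.log d)) ^ p * powerCost c p z := hA as z hz
      _ ≤ (288 * (p * Real.log d)) ^ p * (3 ^ p * S ^ p) := by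
          refine mul_le_mul_of_nonneg_left (hle.trans ?_) (Real.rpow_nonneg hB0 _)
          exact mul_le_mul_of_nonneg_right hexp (Real.rpow_nonneg hS0 _)
      _ = _ := by rw [← Real.mul_rpow (by norm_num) hS0, ← Real.mul_rpow hB0 (by positivity)]
  have h2 := (Real.rpow_le_rpow_iff hk (by positivity) hp0).1 h1
  refine h2.trans_eq ?_
  rw [hpdef]; ring

end Online

end OnlineCovering

open OnlineCovering in
theorem mainTheorem3 :
    (∃ C : ℝ, 0 < C ∧
      ∀ (n l d : ℕ) (p : ℝ) (c : Fin l → Fin n → ℝ), 2 ≤ d → 2 ≤ p →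
        (∀ k i, 0 ≤ c k i) → (∀ k, (Function.support (c k)).ncard ≤ d) →
        ∃ A : Algorithm n,
          A.IsCompetitive (powerCost c p) ((C * (p * Real.log d)) ^ p) ∧
          A.IsCompetitive (normCost c (ENNReal.ofReal p)) (C * (p * Real.log d))) ∧
    (∀ (n l : ℕ) (p : ℝ) (c : Fin l → Fin n → ℝ), 2 ≤ p → (∀ k i, 0 ≤ c k i) →
      ∀ (A : Algorithm n) (r : ℝ), 0 ≤ r →
        (A.IsCompetitive (powerCost c p) (r ^ p) ↔
          A.IsCompetitive (normCost c (ENNReal.ofReal p)) r)) ∧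
    (∃ C : ℝ, 0 < C ∧
      ∀ (n l d : ℕ) (c : Fin l → Fin n → ℝ), 2 ≤ d → 2 ≤ l →
        (∀ k i, 0 ≤ c k i) → (∀ k, (Function.support (c k)).ncard ≤ d) →
        ∃ A : Algorithm n,
          A.IsCompetitive (normCost c ⊤) (C * (Real.log l * Real.log d))) := by
  refine ⟨⟨288, by norm_num, fun n l d p c hd hp hc hsp => ?_⟩,
    fun n l p c hp hc A r hr => isCompetitive_powerCost_iff hp hc A hr,
    ⟨2592, by norm_num, fun n l d c hd hl hc hsp =>
      exists_isCompetitive_normCost_top hc hd hl hsp⟩⟩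
  obtain ⟨A, hA⟩ := exists_isCompetitive_powerCost hp hc hd hsp
  have hlog : 0 ≤ Real.log d := Real.log_nonneg (by exact_mod_cast (by linarith : 1 ≤ d))
  exact ⟨A, hA, (isCompetitive_powerCost_iff hp hc A (by positivity)).1 hA⟩
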